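/- Let $f:\mathbb R^d\to\mathbb R$, let $\beta\in[0,1)$, $s\ge 0$, $\mathbf x_0\in\mathbb R^d$ (deterministic), and let $(\gamma_t)_{t\ge0}$ be real stepsizes. Let $\xi_0,\xi_1,\dots$ be random variables on a probability space $(\Omega,\mathcal F,\mathbb P)$ with values in a measurable space $S$, and let $\mathbf g:\mathbb R^d\times S\to\mathbb R^d$ be jointly measurable (the stochastic oracle). The Stochastic Unified Momentum iterates are defined by $\mathbf y^s_0=\mathbf x_0$ and, for $t\ge 0$, with $\mathbf g_t=\mathbf g(\mathbf x_t,\xi_t)$, $$\mathbf y_{t+1}=\mathbf x_t-\gamma_t\mathbf g_t,\qquad \mathbf y^s_{t+1}=\mathbf x_t-s\gamma_t\mathbf g_t,\qquad \mathbf x_{t+1}=\mathbf y_{t+1}+\beta(\mathbf y^s_{t+1}-\mathbf y^s_t).$$ (For $s=1/(1-\beta)$ this is stochastic gradient descent with stepsizes $\gamma_t/(1-\beta)$, for $s=0$ the stochastic heavy ball method, for $s=1$ the stochastic Nesterov accelerated gradient method.) Assume: (A.1) $f$ is continuously differentiable and $\inf_{\mathbf x} f(\mathbf x)>-\infty$.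 (A.2) There are $\alpha\in(0,1]$ and $A>0$ with $\|\nabla f(\mathbf x)-\nabla f(\mathbf y)\|\le A\|\mathbf x-\mathbf y\|^\alpha$ for all $\mathbf x,\mathbf y\in\mathbb R^d$. (A.3) $\mathbb E[\mathbf g(\mathbf x,\xi_t)]=\nabla f(\mathbf x)$ for all $\mathbf x\in\mathbb R^d$ and $t\ge 0$. (A.4) There are constants $\sigma^2>0$ and $C>0$ with $\mathbb E\|\mathbf g(\mathbf x,\xi_t)-\nabla f(\mathbf x)\|^2\le\sigma^2+C\|\nabla f(\mathbf x)\|^2$ for all $\mathbf x\in\mathbb R^d$ and $t\ge 0$. (A.5) The random variables $(\xi_t)_{t\ge0}$ are (mutually) independent. (A.6) $(\gamma_t)_{t\ge0}$ is deterministic and nonnegative, with $\sum_{t=0}^\infty\gamma_t=\infty$ and $\sum_{t=0}^\infty\gamma_t^{1+\alpha}<\infty$ (the $\alpha$ of (A.2)). Then: (i) $f(\mathbf x_t)$ converges almost surely as $t\to\infty$; (ii) $\nabla f(\mathbf x_t)\to 0$ almost surely; (iii) if, in addition, $\lim_{\|\mathbf x\|\to\infty}f(\mathbf x)=+\infty$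 and for all $a<b$ the set $\{\mathbf x\in\mathbb R^d: a\le f(\mathbf x)\le b\}$ contains only finitely many critical points of $f$, then $\mathbf x_t$ converges almost surely. -/

import Mathlib

open Filter Topology MeasureTheory ProbabilityTheory

namespace StochasticUnifiedMomentum

noncomputable section

variable {V S : Type*} [AddCommGroup V] [Module ℝ V]

/-- The pair `(x_t, y_t^s)` of the Stochastic Unified Momentum method run with the oracle `g`,
momentum factor `β`, parameter `s`, stepsizes `γ`, initial point `x₀` and the samples
`ξ 0, ξ 1, …`. It starts at `x_0 = y_0^s = x₀`; with `g_t = g (x_t) (ξ t)` a step is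
`y_{t+1} = x_t - γ_t g_t`, `y_{t+1}^s = x_t - s γ_t g_t`,
`x_{t+1} = y_{t+1} + β (y_{t+1}^s - y_t^s)`. -/
def state (g : V → S → V) (β s : ℝ) (γ : ℕ → ℝ) (x₀ : V) (ξ : ℕ → S) : ℕ → V × V
  | 0 => (x₀, x₀)
  | t + 1 =>
    let x := (state g β s γ x₀ ξ t).1
    let ys := (state g β s γ x₀ ξ t).2
    let gt := g x (ξ t)
    let y' := x - γ t • gt
    let ys' := x - (s * γ t) • gt
    (y' + β • (ys' - ys), ys')

/-- The iterate `x_t` of the Stochastic Unified Momentum method. -/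
def iterate (g : V → S → V) (β s : ℝ) (γ : ℕ → ℝ) (x₀ : V) (ξ : ℕ → S) (t : ℕ) : V :=
  (state g β s γ x₀ ξ t).1

/-- For `s = 1 / (1 - β)` the method is stochastic gradient descent with
stepsizes `γ_t / (1 - β)`. -/
theorem iterate_sgd (g : V → S → V) (β : ℝ) (hβ : β < 1) (γ : ℕ → ℝ) (x₀ : V) (ξ : ℕ → S)
    (t : ℕ) :
    iterate g β (1 / (1 - β)) γ x₀ ξ (t + 1) =
      iterate g β (1 / (1 - β)) γ x₀ ξ t -
        (γ t / (1 - β)) • g (iterate g β (1 / (1 - β)) γ x₀ ξ t) (ξ t) := by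
  have hne : (1 - β) ≠ 0 := by linarith
  have key : ∀ t, (state g β (1 / (1 - β)) γ x₀ ξ t).1 = (state g β (1 / (1 - β)) γ x₀ ξ t).2 := by
    intro t
    induction t with
    | zero => rfl
    | succ t ih =>
      simp only [state]
      rw [← ih]
      match_scalars <;> field_simp <;> ring
  have h := key (t + 1)
  unfold iterate
  rw [h]
  simp only [state]
  congr 2
  ring

/-- For `s = 0` the method is the stochastic heavy ball method. -/
theorem iterate_heavyBall (g : V → S → V) (β : ℝ) (γ : ℕ → ℝ) (x₀ : V) (ξ : ℕ → S) :
    ∃ m : ℕ → V, m 0 = 0 ∧ ∀ t,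
      m (t + 1) = β • m t - γ t • g (iterate g β 0 γ x₀ ξ t) (ξ t) ∧
      iterate g β 0 γ x₀ ξ (t + 1) = iterate g β 0 γ x₀ ξ t + m (t + 1) := by
  refine ⟨fun t => (state g β 0 γ x₀ ξ t).1 - (state g β 0 γ x₀ ξ t).2, by simp [state], ?_⟩
  intro t
  constructor
  · simp only [state, iterate]
    module
  · simp only [state, iterate]
    module

/-- For `s = 1` the method is the stochastic Nesterov accelerated gradient method. -/
theorem iterate_nesterov (g : V → S → V) (β : ℝ) (γ : ℕ → ℝ) (x₀ : V) (ξ : ℕ → S) :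
    ∃ y : ℕ → V, y 0 = x₀ ∧ ∀ t,
      y (t + 1) = iterate g β 1 γ x₀ ξ t - γ t • g (iterate g β 1 γ x₀ ξ t) (ξ t) ∧
      iterate g β 1 γ x₀ ξ (t + 1) = y (t + 1) + β • (y (t + 1) - y t) := by
  refine ⟨fun t => (state g β 1 γ x₀ ξ t).2, rfl, fun t => ⟨?_, ?_⟩⟩
  · simp [state, iterate]
  · simp [state, iterate]

end

end StochasticUnifiedMomentum

/-! Put `m = x - y^s` and `z = x + β / (1 - β) • m`. Then `z` performs plain stochastic gradient
steps of size `γ / (1 - β)`, with the oracle still evaluated at `x`, while `m` is contracted by `β`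
and driven by `κ γ g`, where `κ = 1 - (1 - β) s`. The Hölder condition bounds the gap between the
gradients at `z` and `x` by a multiple of `‖m‖ ^ α`. Hence for a suitable `l` the function `f z + l
‖m‖ ^ (1 + α)` decreases up to mean-zero noise and an error of order `γ ^ (1 + α)`
(`exists_lyapunov_step_bound`).

All the probability goes into one nonnegative process. To this function, shifted by the lower bound
`b` of `f`, are added the remaining error budget (a tail of `∑ γ ^ (1 + α)`), the decrease `Q`
accumulated so far, and `‖N + a‖ ^ 2`, where `N` is the accumulated noise and `a` a fixed vector.
For large `t` the decrease pays for the gradient-dependent part of the variance, so the process does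
not increase in conditional expectation and converges almost surely for each `a`. Boundedness of `Q`
gives summability of `γ ‖∇f x‖ ^ 2` and of `‖m‖ ^ (1 + α)`; comparing `a = 0` with the basis vectors
shows that `N` converges; what remains gives convergence of `f z`.

The rest is pathwise. Up to a convergent perturbation, `x` follows `-∑ γ ∇f x`, and
`tendsto_zero_of_recursion` sends the gradient to zero. As `m` tends to zero, `f x` converges with
`f z`. For (iii), the iterates are bounded, their increments vanish, and their cluster points are
critical points on one level set; finiteness leaves a single limit. -/

/-! ### Almost sure convergence of nonnegative supermartingales and of Lyapunov functions. -/

/-- A nonnegative adapted process whose integrals over past events do not increase converges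
almost surely; the process need not be integrable. -/
theorem ae_tendsto_of_setLIntegral_succ_le {Ω : Type*} {m0 : MeasurableSpace Ω} {μ : Measure Ω}
    [IsFiniteMeasure μ] (F : Filtration ℕ m0) (V : ℕ → Ω → ℝ)
    (hV : ∀ n, Measurable[F n] (V n)) (h0 : ∀ n ω, 0 ≤ V n ω)
    (h : ∀ n s, MeasurableSet[F n] s →
      ∫⁻ ω in s, ENNReal.ofReal (V (n + 1) ω) ∂μ ≤ ∫⁻ ω in s, ENNReal.ofReal (V n ω) ∂μ) :
    ∀ᵐ ω ∂μ, ∃ l, Tendsto (fun n => V n ω) atTop (𝓝 l) := by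
  have key : ∀ k : ℕ, ∀ᵐ ω ∂μ, V 0 ω ≤ k → ∃ l, Tendsto (fun n => V n ω) atTop (𝓝 l) := by
    intro k
    -- Localization: on this event of the initial σ-algebra the process is integrable and bounded in
    -- `L¹`, so Doob's theorem applies; these events exhaust `Ω` as `k` grows.
    let D : Set Ω := {ω | V 0 ω ≤ k}
    have hD : ∀ n, MeasurableSet[F n] D := fun n =>
      F.mono (Nat.zero_le n) _ (hV 0 measurableSet_Iic)
    let Z : ℕ → Ω → ℝ := fun n => D.indicator (V n)
    have hZF : ∀ n, Measurable[F n] (Z n) := fun n => (hV n).indicator (hD n)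
    have hZm : ∀ n, Measurable (Z n) := fun n => (hZF n).mono (F.le n) le_rfl
    have hZ0 : ∀ n ω, 0 ≤ Z n ω := fun n ω => Set.indicator_nonneg (fun ω _ => h0 n ω) ω
    have hZl : ∀ n s, MeasurableSet[F n] s → ∫⁻ ω in s, ENNReal.ofReal (Z n ω) ∂μ =
        ∫⁻ ω in s ∩ D, ENNReal.ofReal (V n ω) ∂μ := by
      intro n s _
      have e : (fun ω => ENNReal.ofReal (Z n ω)) =
          D.indicator (fun ω => ENNReal.ofReal (V n ω)) := by
        ext ω
        by_cases hω : ω ∈ D <;> simp [Z, hω]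
      rw [e, setLIntegral_indicator (F.le n _ (hD n)), Set.inter_comm]
    have hstep : ∀ n s, MeasurableSet[F n] s → ∫⁻ ω in s, ENNReal.ofReal (Z (n + 1) ω) ∂μ ≤
        ∫⁻ ω in s, ENNReal.ofReal (Z n ω) ∂μ := by
      intro n s hs
      rw [hZl n s hs, hZl (n + 1) s (F.mono (Nat.le_succ n) _ hs)]
      exact h n _ (@MeasurableSet.inter _ (F n) _ _ hs (hD n))
    have hbd : ∀ n, ∫⁻ ω, ENNReal.ofReal (Z n ω) ∂μ ≤ k * μ Set.univ := by
      intro n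
      induction n with
      | zero =>
        calc ∫⁻ ω, ENNReal.ofReal (Z 0 ω) ∂μ ≤ ∫⁻ _, (k : ENNReal) ∂μ := by
              refine lintegral_mono fun ω => ?_
              by_cases hω : ω ∈ D
              · simpa [Z, hω] using ENNReal.ofReal_le_ofReal (show V 0 ω ≤ k from hω)
              · simp [Z, hω]
          _ = _ := by simp
      | succ n ih =>
        have := hstep n Set.univ (@MeasurableSet.univ _ (F n))
        simp only [Measure.restrict_univ] at this
        exact this.trans ih
    have hfin : (k : ENNReal) * μ Set.univ < ⊤ :=
      ENNReal.mul_lt_top (ENNReal.natCast_lt_top k) (measure_lt_top μ _)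
    have hint : ∀ n, Integrable (Z n) μ := fun n => by
      refine ⟨(hZm n).aestronglyMeasurable, ?_⟩
      rw [hasFiniteIntegral_iff_ofReal (Eventually.of_forall (hZ0 n))]
      exact (hbd n).trans_lt hfin
    have hsup : Supermartingale Z F μ := by
      refine supermartingale_of_setIntegral_succ_le
        (fun n => (hZF n).stronglyMeasurable) hint fun n s hs => ?_
      rw [integral_eq_lintegral_of_nonneg_ae (Eventually.of_forall (hZ0 _))
        (hZm _).aestronglyMeasurable, integral_eq_lintegral_of_nonneg_ae
        (Eventually.of_forall (hZ0 _)) (hZm _).aestronglyMeasurable]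
      refine ENNReal.toReal_mono ?_ (hstep n s hs)
      exact ((setLIntegral_le_lintegral _ _).trans_lt ((hbd n).trans_lt hfin)).ne
    have hconv := hsup.neg.ae_tendsto_limitProcess (R := ((k : ENNReal) * μ Set.univ).toNNReal) <| by
      intro n
      rw [ENNReal.coe_toNNReal hfin.ne, eLpNorm_one_eq_lintegral_enorm]
      refine le_trans (le_of_eq ?_) (hbd n)
      refine lintegral_congr fun ω => ?_
      simp only [Pi.neg_apply, enorm_neg]
      exact Real.enorm_of_nonneg (hZ0 n ω)
    filter_upwards [hconv] with ω hω hk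
    refine ⟨_, hω.neg.congr fun n => ?_⟩
    have : ω ∈ D := hk
    simp [Z, this]
  filter_upwards [ae_all_iff.2 key] with ω hω
  obtain ⟨k, hk⟩ := exists_nat_ge (V 0 ω)
  exact hω k hk

/-- By independence the joint law of past and sample is a product, so Tonelli integrates the sample
out with `X` frozen. The indicator of `s` is carried along with `X` as part of the past. Working in
`ENNReal` avoids any integrability condition. -/
theorem setLIntegral_comp_le_of_indep {Ω H S : Type*} {F m0 : MeasurableSpace Ω}
    [MeasurableSpace H] [MeasurableSpace S] {μ : Measure Ω} [IsProbabilityMeasure μ]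
    (hF : F ≤ m0) {ξ : Ω → S} (hξ : Measurable ξ)
    (hind : Indep F (MeasurableSpace.comap ξ inferInstance) μ)
    {X : Ω → H} (hX : Measurable[F] X) {Φ : H → S → ENNReal}
    (hΦ : Measurable (Function.uncurry Φ)) {ψ : H → ENNReal}
    (h : ∀ x, ∫⁻ ω, Φ x (ξ ω) ∂μ ≤ ψ x) {s : Set Ω} (hs : MeasurableSet[F] s) :
    ∫⁻ ω in s, Φ (X ω) (ξ ω) ∂μ ≤ ∫⁻ ω in s, ψ (X ω) ∂μ := by
  let Y : Ω → ENNReal × H := fun ω => (s.indicator (fun _ => 1) ω, X ω)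
  have hYF : Measurable[F] Y :=
    (Measurable.indicator (measurable_const) hs).prodMk hX
  have hY : Measurable Y := hYF.mono hF le_rfl
  have hYξ : IndepFun Y ξ μ :=
    (IndepFun_iff_Indep Y ξ μ).2 (indep_of_indep_of_le_left hind hYF.comap_le)
  have hs' : MeasurableSet s := hF _ hs
  have hind_mul : ∀ u : Ω → ENNReal, ∫⁻ ω in s, u ω ∂μ =
      ∫⁻ ω, s.indicator (fun _ => 1) ω * u ω ∂μ := by
    intro u
    rw [← lintegral_indicator hs']
    refine lintegral_congr fun ω => ?_
    by_cases hω : ω ∈ s <;> simp [hω]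
  let Φ' : (ENNReal × H) × S → ENNReal := fun p => p.1.1 * Φ p.1.2 p.2
  have hΦ' : Measurable Φ' := by
    refine (measurable_fst.fst).mul ?_
    exact hΦ.comp ((measurable_fst.snd).prodMk measurable_snd)
  have hΦx : ∀ x, Measurable (Φ x) := fun x => hΦ.comp (measurable_const.prodMk measurable_id)
  rw [hind_mul, hind_mul]
  calc ∫⁻ ω, s.indicator (fun _ => 1) ω * Φ (X ω) (ξ ω) ∂μ
      = ∫⁻ p, Φ' p ∂(μ.map fun ω => (Y ω, ξ ω)) :=
        (lintegral_map hΦ' (hY.prodMk hξ)).symm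
    _ = ∫⁻ y, ∫⁻ t, Φ' (y, t) ∂(μ.map ξ) ∂(μ.map Y) := by
        rw [(indepFun_iff_map_prod_eq_prod_map_map hY.aemeasurable hξ.aemeasurable).1 hYξ,
          lintegral_prod _ hΦ'.aemeasurable]
    _ = ∫⁻ ω, ∫⁻ t, Φ' (Y ω, t) ∂(μ.map ξ) ∂μ := lintegral_map hΦ'.lintegral_prod_right' hY
    _ ≤ _ := by
        refine lintegral_mono fun ω => ?_
        simp only [Φ', Y]
        rw [lintegral_const_mul _ (hΦx _), lintegral_map (hΦx _) hξ]
        gcongr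
        exact h _

/-- Almost sure convergence of a nonnegative Lyapunov function that eventually does not increase in
expectation along a stochastic recursion driven by independent samples. -/
theorem ae_tendsto_lyapunov_of_iIndepFun {Ω H S : Type*} {m0 : MeasurableSpace Ω}
    [MeasurableSpace H] [MeasurableSpace S] {μ : Measure Ω} [IsProbabilityMeasure μ]
    {ξ : ℕ → Ω → S} (hξ : ∀ t, Measurable (ξ t)) (hind : iIndepFun ξ μ)
    {step : ℕ → H → S → H} (hstep : ∀ t, Measurable (Function.uncurry (step t)))
    {X : ℕ → Ω → H} {h₀ : H} (hX0 : ∀ ω, X 0 ω = h₀)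
    (hX : ∀ t ω, X (t + 1) ω = step t (X t ω) (ξ t ω))
    {Ψ : ℕ → H → ℝ} (hΨm : ∀ t, Measurable (Ψ t)) (T : ℕ) (hΨ0 : ∀ t ω, 0 ≤ Ψ t (X t ω))
    (hΨ : ∀ t, T ≤ t → ∀ h, ∫⁻ ω, ENNReal.ofReal (Ψ (t + 1) (step t h (ξ t ω))) ∂μ ≤
      ENNReal.ofReal (Ψ t h)) :
    ∀ᵐ ω ∂μ, ∃ l, Tendsto (fun t => Ψ t (X t ω)) atTop (𝓝 l) := by
  -- Only samples with index strictly below `t`: this suffices to determine `X t` and leaves `ξ t`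
  -- independent of it.
  let F : ℕ → MeasurableSpace Ω := fun t =>
    ⨆ i ∈ Set.Iio t, MeasurableSpace.comap (ξ i) inferInstance
  have hFle : ∀ t, F t ≤ m0 := fun t => iSup₂_le fun i _ => (hξ i).comap_le
  have hFmono : Monotone F := fun s t hst =>
    biSup_mono fun i hi => lt_of_lt_of_le hi hst
  have hξF : ∀ t, Measurable[F (t + 1)] (ξ t) := fun t =>
    Measurable.mono (comap_measurable (ξ t))
      (le_iSup₂_of_le t (Nat.lt_succ_self t) le_rfl) le_rfl
  have hindF : ∀ t, Indep (F t) (MeasurableSpace.comap (ξ t) inferInstance) μ := by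
    intro t
    have := indep_iSup_of_disjoint (fun i => (hξ i).comap_le) hind
      (S := Set.Iio t) (T := {t}) (by simp)
    simpa [F] using this
  have hXF : ∀ t, Measurable[F t] (X t) := by
    intro t
    induction t with
    | zero =>
      have : X 0 = fun _ => h₀ := funext hX0
      rw [this]
      exact measurable_const
    | succ t ih =>
      have : X (t + 1) = fun ω => Function.uncurry (step t) (X t ω, ξ t ω) := funext (hX t)
      rw [this]
      exact (hstep t).comp ((ih.mono (hFmono (Nat.le_succ t)) le_rfl).prodMk (hξF t))
  let G : Filtration ℕ m0 :=
    ⟨fun n => F (n + T), fun a b hab => hFmono (by omega), fun n => hFle _⟩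
  have := ae_tendsto_of_setLIntegral_succ_le (μ := μ) G (fun n ω => Ψ (n + T) (X (n + T) ω))
    (fun n => (hΨm _).comp (hXF _)) (fun n ω => hΨ0 _ _) (by
      intro n s hs
      have e : ∀ ω, X (n + 1 + T) ω = step (n + T) (X (n + T) ω) (ξ (n + T) ω) := fun ω => by
        rw [← hX, show n + T + 1 = n + 1 + T by omega]
      simp only [e]
      refine setLIntegral_comp_le_of_indep (hFle _) (hξ _) (hindF _) (hXF _)
        (Φ := fun h u => ENNReal.ofReal (Ψ (n + 1 + T) (step (n + T) h u)))
        (ψ := fun h => ENNReal.ofReal (Ψ (n + T) h)) ?_ ?_ hs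
      · exact ((hΨm _).comp (hstep _)).ennreal_ofReal
      · intro h
        have := hΨ (n + T) (by omega) h
        rwa [show n + T + 1 = n + 1 + T by omega] at this)
  filter_upwards [this] with ω ⟨l, hl⟩
  exact ⟨l, (tendsto_add_atTop_iff_nat (f := fun t => Ψ t (X t ω)) T).1 hl⟩

/-! ### Deterministic estimates and limit lemmas. -/

section Deterministic

/-- Absorbs the squared gradient gap between `z` and `x`. For `m ≤ 1` the left side is at most `γ *
m ^ α`, hence at most the `(1 + α)`-th power of the larger of `γ` and `m`; for `m ≥ 1` the condition
`α ≤ 1` gives `m ^ (2 * α) ≤ m ^ (1 + α)`. -/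
theorem mul_rpow_sq_le {α γ m : ℝ} (hα0 : 0 < α) (hα1 : α ≤ 1) (hγ0 : 0 ≤ γ) (hγ1 : γ ≤ 1)
    (hm : 0 ≤ m) : γ * (m ^ α) ^ 2 ≤ γ ^ (1 + α) + m ^ (1 + α) := by
  have hp : 1 + α ≠ 0 := by positivity
  have e : ∀ y : ℝ, 0 ≤ y → y ^ (1 + α) = y * y ^ α := fun y hy => by
    rw [Real.rpow_add' hy hp, Real.rpow_one]
  have hmα : 0 ≤ m ^ α := by positivity
  have hγα : 0 ≤ γ ^ α := by positivity
  rw [e γ hγ0, e m hm]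
  rcases le_total m 1 with h1 | h1
  · have h2 : m ^ α ≤ 1 := Real.rpow_le_one hm h1 hα0.le
    have h3 : γ * (m ^ α) ^ 2 ≤ γ * m ^ α := by
      gcongr
      nlinarith
    rcases le_total γ m with h | h
    · nlinarith [mul_le_mul_of_nonneg_right h hmα, mul_nonneg hγ0 hγα]
    · have : m ^ α ≤ γ ^ α := by gcongr
      nlinarith [mul_le_mul_of_nonneg_left this hγ0, mul_nonneg hm hmα]
  · have h2 : m ^ α ≤ m := by
      simpa using Real.rpow_le_rpow_of_exponent_le h1 hα1
    calc γ * (m ^ α) ^ 2 ≤ 1 * (m ^ α * m ^ α) := by rw [sq]; gcongr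
      _ ≤ m * m ^ α := by rw [one_mul]; gcongr
      _ ≤ _ := by linarith [mul_nonneg hγ0 hγα]

theorem rpow_le_one_add_sq {p y : ℝ} (hp0 : 0 ≤ p) (hp2 : p ≤ 2) (hy : 0 ≤ y) :
    y ^ p ≤ 1 + y ^ 2 := by
  rcases le_total y 1 with h | h
  · have := Real.rpow_le_one hy h hp0
    nlinarith [sq_nonneg y]
  · have := Real.rpow_le_rpow_of_exponent_le h hp2
    rw [Real.rpow_two] at this
    linarith

/-- Convexity of the power with weights `β` and `1 - β` keeps the contraction factor exactly `β` in
front of `a ^ p`. -/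
theorem convexComb_rpow_le {β p a b : ℝ} (hβ0 : 0 ≤ β) (hβ1 : β < 1) (hp : 1 ≤ p) (ha : 0 ≤ a)
    (hb : 0 ≤ b) : (β * a + b) ^ p ≤ β * a ^ p + (1 - β) * (b / (1 - β)) ^ p := by
  have h1 : 0 < 1 - β := by linarith
  have := (convexOn_rpow hp).2 (x := a) ha (y := b / (1 - β)) (by simp; positivity) hβ0 h1.le
    (by ring)
  simp only [smul_eq_mul] at this
  rwa [mul_div_cancel₀ _ h1.ne'] at this

variable {E : Type*} [NormedAddCommGroup E] [InnerProductSpace ℝ E]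

/-- First order Taylor estimate for a function with Hölder continuous gradient. -/
theorem abs_sub_sub_inner_gradient_le [CompleteSpace E] {f : E → ℝ} (hf : Differentiable ℝ f)
    {A α : ℝ} (hA : 0 ≤ A) (hα : 0 < α)
    (hH : ∀ x y, ‖gradient f x - gradient f y‖ ≤ A * ‖x - y‖ ^ α) (z v : E) :
    |f (z + v) - f z - inner ℝ (gradient f z) v| ≤ A * ‖v‖ ^ (1 + α) := by
  -- The mean value theorem suffices here, at the cost of the constant `A` instead of `A / (1 + α)`.
  obtain ⟨w, hw, he⟩ := domain_mvt (f := f) (s := Set.univ) (x := z) (y := z + v)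
    (f' := fun x => fderiv ℝ f x) (fun x _ => (hf x).hasFDerivAt.hasFDerivWithinAt)
    convex_univ trivial trivial
  have hg : fderiv ℝ f w (z + v - z) = inner ℝ (gradient f w) v := by
    rw [add_sub_cancel_left, gradient, InnerProductSpace.toDual_symm_apply]
  rw [he, hg, ← inner_sub_left]
  have hwz : ‖w - z‖ ≤ ‖v‖ := by
    obtain ⟨t, ht, rfl⟩ := (segment_eq_image' ℝ z (z + v)) ▸ hw
    simp only [add_sub_cancel_left, norm_smul, Real.norm_eq_abs, abs_of_nonneg ht.1]
    exact mul_le_of_le_one_left (norm_nonneg _) ht.2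
  calc |inner ℝ (gradient f w - gradient f z) v| ≤ ‖gradient f w - gradient f z‖ * ‖v‖ :=
        abs_real_inner_le_norm _ _
    _ ≤ A * ‖v‖ ^ α * ‖v‖ := by
        gcongr
        exact (hH w z).trans (by gcongr)
    _ = A * ‖v‖ ^ (1 + α) := by
        rw [Real.rpow_add' (norm_nonneg _) (by positivity), Real.rpow_one]; ring

/-- One step of the momentum method, written in terms of the auxiliary sequence `z` and the
momentum `m`, changes the Lyapunov function `f z + l ‖m‖ ^ (1 + α)` by at most the stated amount. -/
theorem exists_lyapunov_step_bound [CompleteSpace E] {f : E → ℝ} (hf : Differentiable ℝ f)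
    {A α : ℝ} (hA : 0 ≤ A) (hα0 : 0 < α) (hα1 : α ≤ 1)
    (hH : ∀ x y, ‖gradient f x - gradient f y‖ ≤ A * ‖x - y‖ ^ α)
    {β : ℝ} (hβ0 : 0 ≤ β) (hβ1 : β < 1) (κ : ℝ) :
    ∃ l K : ℝ, 0 ≤ l ∧ 0 ≤ K ∧ ∀ (γ : ℝ) (z m δ G : E), 0 ≤ γ → γ ≤ 1 →
      G = gradient f (z - (β / (1 - β)) • m) →
      f (z - (γ / (1 - β)) • (G + δ)) + l * ‖β • m - (κ * γ) • (G + δ)‖ ^ (1 + α) ≤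
        f z + l * ‖m‖ ^ (1 + α) - ‖m‖ ^ (1 + α) - γ / 2 * ‖G‖ ^ 2
          - γ / (1 - β) * inner ℝ (gradient f z) δ
          + γ ^ (1 + α) * (K * (1 + ‖G‖ ^ 2 + ‖δ‖ ^ 2)) := by
  have hb : 0 < 1 - β := by linarith
  set r := 1 / (1 - β) with hr
  have hr0 : 0 < r := by positivity
  have hr1 : 1 ≤ r := by rw [hr, le_div_iff₀ hb]; linarith
  set c := β / (1 - β) with hc
  have hc0 : 0 ≤ c := by positivity
  set p := 1 + α with hp
  set K₁ := r / 2 * (A * c ^ α) ^ 2 with hK₁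
  have hK₁0 : 0 ≤ K₁ := by positivity
  -- Chosen so that `l * β + K₁ = l - 1`: contraction of the momentum pays for the gradient gap `K₁
  -- * ‖m‖ ^ p` and leaves one full `‖m‖ ^ p` of decrease.
  set l := (K₁ + 1) * r with hl
  have hl0 : 0 ≤ l := by positivity
  have hlβ : l * β + K₁ = l - 1 := by rw [hl, hr]; field_simp; ring
  set B := A * r ^ p + l * ((1 - β) * (|κ| * r) ^ p) with hB
  have hB0 : 0 ≤ B := by positivity
  refine ⟨l, K₁ + 2 * B, hl0, by positivity, ?_⟩
  intro γ z m δ G hγ0 hγ1 hG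
  set g := G + δ with hg
  have hη : γ / (1 - β) = r * γ := by rw [hr]; ring
  have hg2 : ‖g‖ ^ 2 ≤ 2 * ‖G‖ ^ 2 + 2 * ‖δ‖ ^ 2 := by
    have := norm_add_le G δ
    nlinarith [sq_nonneg (‖G‖ - ‖δ‖), norm_nonneg g]
  have hgp : ‖g‖ ^ p ≤ 1 + 2 * ‖G‖ ^ 2 + 2 * ‖δ‖ ^ 2 := by
    linarith [rpow_le_one_add_sq (p := p) (by positivity) (by linarith) (norm_nonneg g)]
  have hT : f (z - (r * γ) • g) ≤ f z - r * γ * inner ℝ (gradient f z) g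
      + A * r ^ p * (γ ^ p * ‖g‖ ^ p) := by
    have := le_of_abs_le (abs_sub_sub_inner_gradient_le hf hA hα0 hH z (-((r * γ) • g)))
    rw [← sub_eq_add_neg, inner_neg_right, inner_smul_right, norm_neg, norm_smul,
      Real.norm_of_nonneg (by positivity), Real.mul_rpow (by positivity) (norm_nonneg _),
      Real.mul_rpow hr0.le hγ0] at this
    linarith only [this]
  have hM : ‖β • m - (κ * γ) • g‖ ^ p ≤
      β * ‖m‖ ^ p + (1 - β) * (|κ| * r) ^ p * (γ ^ p * ‖g‖ ^ p) := by
    have h1 : ‖β • m - (κ * γ) • g‖ ≤ β * ‖m‖ + |κ| * γ * ‖g‖ := by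
      refine (norm_sub_le _ _).trans (le_of_eq ?_)
      rw [norm_smul, norm_smul, Real.norm_of_nonneg hβ0, Real.norm_eq_abs, abs_mul,
        abs_of_nonneg hγ0]
    refine (Real.rpow_le_rpow (norm_nonneg _) h1 (by positivity)).trans ?_
    refine (convexComb_rpow_le hβ0 hβ1 (by linarith) (norm_nonneg _) (by positivity)).trans
      (le_of_eq ?_)
    rw [show |κ| * γ * ‖g‖ / (1 - β) = (|κ| * r) * (γ * ‖g‖) by rw [hr]; ring,
      Real.mul_rpow (by positivity) (by positivity), Real.mul_rpow hγ0 (norm_nonneg _)]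
    ring
  have hdiff : ‖gradient f z - G‖ ^ 2 ≤ (A * c ^ α) ^ 2 * (‖m‖ ^ α) ^ 2 := by
    rw [← mul_pow]
    have := hH z (z - c • m)
    rw [← hG, sub_sub_cancel, norm_smul, Real.norm_of_nonneg hc0,
      Real.mul_rpow hc0 (norm_nonneg _), ← mul_assoc] at this
    gcongr
  have hinner : -inner ℝ (gradient f z) G ≤ - (1 / 2) * ‖G‖ ^ 2
      + 1 / 2 * ‖gradient f z - G‖ ^ 2 := by
    have := norm_sub_sq_real (gradient f z) G
    nlinarith [sq_nonneg ‖gradient f z‖]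
  have hY := mul_rpow_sq_le hα0 hα1 hγ0 hγ1 (norm_nonneg m)
  have hcross : - (r * γ * inner ℝ (gradient f z) G) ≤ - (γ / 2 * ‖G‖ ^ 2)
      + K₁ * (γ ^ p + ‖m‖ ^ p) := by
    have hrγ : 0 ≤ r * γ := by positivity
    have h1 : r * γ * -inner ℝ (gradient f z) G ≤ r * γ * (- (1 / 2) * ‖G‖ ^ 2
        + 1 / 2 * ((A * c ^ α) ^ 2 * (‖m‖ ^ α) ^ 2)) :=
      mul_le_mul_of_nonneg_left (by linarith) hrγ
    have h2 := mul_le_mul_of_nonneg_left hY hK₁0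
    have h3 : γ * ‖G‖ ^ 2 ≤ r * γ * ‖G‖ ^ 2 :=
      mul_le_mul_of_nonneg_right (le_mul_of_one_le_left hγ0 hr1) (sq_nonneg _)
    have h4 : r * γ * (- (1 / 2) * ‖G‖ ^ 2 + 1 / 2 * ((A * c ^ α) ^ 2 * (‖m‖ ^ α) ^ 2)) =
        - (r * γ * ‖G‖ ^ 2) / 2 + K₁ * (γ * (‖m‖ ^ α) ^ 2) := by rw [hK₁]; ring
    rw [h4] at h1
    linarith only [h1, h2, h3]
  have hγp : 0 ≤ γ ^ p := by positivity
  have hBg : B * (γ ^ p * ‖g‖ ^ p) ≤ B * (γ ^ p * (1 + 2 * ‖G‖ ^ 2 + 2 * ‖δ‖ ^ 2)) := by gcongr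
  have hsplit : inner ℝ (gradient f z) g = inner ℝ (gradient f z) G + inner ℝ (gradient f z) δ := by
    rw [hg, inner_add_right]
  have hlM := mul_le_mul_of_nonneg_left hM hl0
  have hmβ : l * (β * ‖m‖ ^ p) = (l - 1 - K₁) * ‖m‖ ^ p := by
    rw [← hlβ]; ring
  have hrest : K₁ * γ ^ p + B * (γ ^ p * (1 + 2 * ‖G‖ ^ 2 + 2 * ‖δ‖ ^ 2)) ≤
      γ ^ p * ((K₁ + 2 * B) * (1 + ‖G‖ ^ 2 + ‖δ‖ ^ 2)) := by
    have h1 : 0 ≤ γ ^ p * (B + K₁ * (‖G‖ ^ 2 + ‖δ‖ ^ 2)) := by positivity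
    have h2 : γ ^ p * ((K₁ + 2 * B) * (1 + ‖G‖ ^ 2 + ‖δ‖ ^ 2)) =
        K₁ * γ ^ p + B * (γ ^ p * (1 + 2 * ‖G‖ ^ 2 + 2 * ‖δ‖ ^ 2)) +
          γ ^ p * (B + K₁ * (‖G‖ ^ 2 + ‖δ‖ ^ 2)) := by ring
    linarith only [h1, h2]
  rw [hη]
  rw [hsplit] at hT
  have hBe : B * (γ ^ p * ‖g‖ ^ p) = A * r ^ p * (γ ^ p * ‖g‖ ^ p)
      + l * ((1 - β) * (|κ| * r) ^ p * (γ ^ p * ‖g‖ ^ p)) := by rw [hB]; ring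
  linarith only [hT, hlM, hcross, hBg, hrest, hBe, hmβ]

/-- A gradient-type recursion with summable `γ t * ‖G (x t)‖ ^ 2`, divergent stepsizes and a
convergent accumulated perturbation `w` drives the Hölder continuous field `G` to zero. -/
theorem tendsto_zero_of_recursion {G : E → E} {A α r : ℝ} (hA : 0 < A) (hα : 0 < α) (hr : 0 ≤ r)
    (hH : ∀ x y, ‖G x - G y‖ ≤ A * ‖x - y‖ ^ α) {γ : ℕ → ℝ} (hγ : ∀ t, 0 ≤ γ t)
    (hγ1 : Tendsto (fun n => ∑ t ∈ Finset.range n, γ t) atTop atTop) {x w : ℕ → E}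
    (hx : ∀ t, x t = w t - r • ∑ i ∈ Finset.range t, γ i • G (x i)) {w' : E}
    (hw : Tendsto w atTop (𝓝 w')) (hs : Summable fun t => γ t * ‖G (x t)‖ ^ 2) :
    Tendsto (fun t => G (x t)) atTop (𝓝 0) := by
  rw [Metric.tendsto_atTop]
  intro ε' hε'
  set ε := ε' / 2 with hε
  have hε0 : 0 < ε := by positivity
  -- Otherwise `γ` would be dominated by `γ * ‖G‖ ^ 2 / ε ^ 2` from some time on, hence summable.
  have hinf : ∀ t, ∃ n, t ≤ n ∧ ‖G (x n)‖ < ε := by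
    intro t
    by_contra! hcon
    have hsum : Summable fun n => γ (n + t) := by
      refine Summable.of_nonneg_of_le (fun n => hγ _) (fun n => ?_)
        (((summable_nat_add_iff t).2 hs).mul_left (1 / ε ^ 2))
      have h1 := hcon (n + t) (by omega)
      have h2 : ε ^ 2 ≤ ‖G (x (n + t))‖ ^ 2 := by gcongr
      rw [← mul_assoc, mul_comm (1 / ε ^ 2), mul_assoc]
      refine le_mul_of_one_le_right (hγ _) ?_
      rw [one_div, ← div_eq_inv_mul, le_div_iff₀ (by positivity)]
      linarith
    exact not_tendsto_nhds_of_tendsto_atTop hγ1 _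
      ((summable_nat_add_iff t).1 hsum).hasSum.tendsto_sum_nat
  obtain ⟨δ, hδ0, hδ⟩ : ∃ δ, 0 < δ ∧ A * δ ^ α ≤ ε := by
    refine ⟨(ε / A) ^ (1 / α), by positivity, le_of_eq ?_⟩
    rw [← Real.rpow_mul (by positivity), one_div, inv_mul_cancel₀ hα.ne', Real.rpow_one,
      mul_div_cancel₀ _ hA.ne']
  obtain ⟨T₁, hT₁⟩ := Metric.cauchySeq_iff.1 hw.cauchySeq (δ / 2) (by positivity)
  obtain ⟨T₂, hT₂⟩ := Metric.cauchySeq_iff.1 hs.hasSum.tendsto_sum_nat.cauchySeq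
    (ε * (δ / 2) / (r + 1)) (by positivity)
  refine ⟨max T₁ T₂, fun t ht => ?_⟩
  have ht₁ : T₁ ≤ t := le_of_max_le_left ht
  have ht₂ : T₂ ≤ t := le_of_max_le_right ht
  classical
  -- First time from `t` on at which the field is small. Before it, `γ * ‖G‖ ≤ γ * ‖G‖ ^ 2 / ε`, so
  -- the path from `t` to `n` is short and Hölder continuity carries smallness back to `t`.
  let n := Nat.find (hinf t)
  obtain ⟨htn, hn⟩ : t ≤ n ∧ ‖G (x n)‖ < ε := Nat.find_spec (hinf t)
  have hlt : ∀ i ∈ Finset.Ico t n, ε ≤ ‖G (x i)‖ := by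
    intro i hi
    rw [Finset.mem_Ico] at hi
    by_contra! h
    exact Nat.find_min (hinf t) hi.2 ⟨hi.1, h⟩
  have hdiff : x t - x n = (w t - w n) + r • ∑ i ∈ Finset.Ico t n, γ i • G (x i) := by
    rw [Finset.sum_Ico_eq_sub _ htn, smul_sub]
    nth_rewrite 1 [hx t]
    nth_rewrite 1 [hx n]
    abel
  have hsum : ε * ‖∑ i ∈ Finset.Ico t n, γ i • G (x i)‖ < ε * (δ / 2) / (r + 1) := by
    have h1 := hT₂ n (ht₂.trans htn) t ht₂
    rw [Real.dist_eq, ← Finset.sum_Ico_eq_sub _ htn] at h1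
    refine lt_of_le_of_lt ?_ (lt_of_abs_lt h1)
    refine (mul_le_mul_of_nonneg_left (norm_sum_le _ _) hε0.le).trans ?_
    rw [Finset.mul_sum]
    refine Finset.sum_le_sum fun i hi => ?_
    rw [norm_smul, Real.norm_of_nonneg (hγ i)]
    nlinarith [mul_nonneg (mul_nonneg (hγ i) (norm_nonneg (G (x i))))
      (sub_nonneg.2 (hlt i hi))]
  have hsum' : r * ‖∑ i ∈ Finset.Ico t n, γ i • G (x i)‖ ≤ δ / 2 := by
    rw [lt_div_iff₀ (by positivity)] at hsum
    have h0 := norm_nonneg (∑ i ∈ Finset.Ico t n, γ i • G (x i))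
    nlinarith
  have hxx : ‖x t - x n‖ ≤ δ := by
    have h1 := hT₁ t ht₁ n (ht₁.trans htn)
    rw [dist_eq_norm] at h1
    rw [hdiff]
    refine (norm_add_le _ _).trans ?_
    rw [norm_smul, Real.norm_of_nonneg hr]
    linarith
  rw [dist_zero_right]
  have h1 : ‖G (x t) - G (x n)‖ ≤ ε :=
    (hH _ _).trans (le_trans (by gcongr) hδ)
  have h2 : ‖G (x t)‖ ≤ ‖G (x t) - G (x n)‖ + ‖G (x n)‖ := by
    simpa using norm_add_le (G (x t) - G (x n)) (G (x n))
  linarith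

/-- A bounded sequence with vanishing increments and finitely many cluster points converges. -/
theorem exists_tendsto_of_finite_mapClusterPt {X : Type*} [MetricSpace X] [ProperSpace X]
    {x : ℕ → X} (hb : Bornology.IsBounded (Set.range x))
    (hstep : Tendsto (fun t => dist (x (t + 1)) (x t)) atTop (𝓝 0)) {K : Set X} (hK : K.Finite)
    (hcl : ∀ z, MapClusterPt z atTop x → z ∈ K) : ∃ z, Tendsto x atTop (𝓝 z) := by
  obtain ⟨q, -, hq⟩ := hb.isCompact_closure.exists_mapClusterPt (f := atTop) (u := x)
    (by
      rw [le_principal_iff, mem_map]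
      exact Eventually.of_forall fun t => subset_closure (Set.mem_range_self t))
  refine ⟨q, ?_⟩
  have hKq : (K \ {q})ᶜ ∈ 𝓝 q :=
    (hK.subset Set.sdiff_subset).isClosed.isOpen_compl.mem_nhds (by simp)
  obtain ⟨ε₀, hε₀, hball⟩ := Metric.mem_nhds_iff.1 hKq
  rw [Metric.tendsto_atTop]
  intro ε hε
  set e := min ε ε₀ / 3 with he
  have he0 : 0 < e := by positivity
  have hee : 3 * e ≤ ε := by rw [he]; linarith [min_le_left ε ε₀]
  have hee₀ : 3 * e ≤ ε₀ := by rw [he]; linarith [min_le_right ε ε₀]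
  -- The closed annulus is compact and contains no cluster point. Steps shorter than its width `e`
  -- cannot cross it, so the sequence stays trapped near `q`.
  have hann : ∀ᶠ t in atTop, ¬ (e ≤ dist (x t) q ∧ dist (x t) q ≤ 2 * e) := by
    by_contra hcon
    have hfr : ∃ᶠ t in atTop, x t ∈ {y | e ≤ dist y q ∧ dist y q ≤ 2 * e} := by
      simpa [Filter.Frequently] using hcon
    have hcomp : IsCompact {y : X | e ≤ dist y q ∧ dist y q ≤ 2 * e} :=
      (isCompact_closedBall q (2 * e)).of_isClosed_subset
        ((isClosed_le continuous_const (continuous_id.dist continuous_const)).inter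
          (isClosed_le (continuous_id.dist continuous_const) continuous_const)) fun y hy => hy.2
    obtain ⟨y, hy, hyc⟩ := hcomp.exists_mapClusterPt_of_frequently hfr
    have hyK := hcl y hyc
    have hyq : y ≠ q := by
      rintro rfl
      have := hy.1
      rw [dist_self] at this
      linarith
    exact hball (Metric.mem_ball.2 (by linarith [hy.2])) ⟨hyK, hyq⟩
  obtain ⟨T, hT⟩ := eventually_atTop.1 (hann.and (hstep.eventually (gt_mem_nhds he0)))
  obtain ⟨n, hn, hnq⟩ := (hq.frequently (Metric.ball_mem_nhds q he0)).forall_exists_of_atTop T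
  refine ⟨n, fun t ht => lt_of_lt_of_le (b := e) ?_ (by linarith)⟩
  induction t, ht using Nat.le_induction with
  | base => exact hnq
  | succ t ht ih =>
    by_contra! hcon
    refine (hT (t + 1) (by omega)).1 ⟨hcon, ?_⟩
    linarith [dist_triangle (x (t + 1)) (x t) q, (hT t (by omega)).2]

end Deterministic

/-! ### The momentum recursion and its Lyapunov function. -/

section Recursion

variable {E S : Type*} [NormedAddCommGroup E] [InnerProductSpace ℝ E] [CompleteSpace E]

/-- The point `x` at which the oracle is called, recovered from `z = x + β / (1 - β) • m` and the
momentum `m`. -/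
noncomputable def queryPoint (β : ℝ) (h : E × E × E × ℝ) : E :=
  h.1 - (β / (1 - β)) • h.2.1

/-- One step of the momentum method in the coordinates `(z, m, N, Q)`: auxiliary sequence,
momentum, accumulated noise and accumulated decrease of the Lyapunov function. -/
noncomputable def momentumStep (f : E → ℝ) (g : E → S → E) (β κ α : ℝ) (γ : ℕ → ℝ) (t : ℕ)
    (h : E × E × E × ℝ) (u : S) : E × E × E × ℝ :=
  (h.1 - (γ t / (1 - β)) • g (queryPoint β h) u,
    β • h.2.1 - (κ * γ t) • g (queryPoint β h) u,
    h.2.2.1 - (γ t / (1 - β)) • (g (queryPoint β h) u - gradient f (queryPoint β h)),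
    h.2.2.2 + (γ t / 4 * ‖gradient f (queryPoint β h)‖ ^ 2 + ‖h.2.1‖ ^ (1 + α)))

/-- The Lyapunov function of the momentum method. -/
noncomputable def momentumLyapunov (f : E → ℝ) (b α l M : ℝ) (γ : ℕ → ℝ) (a : E) (t : ℕ)
    (h : E × E × E × ℝ) : ℝ :=
  (f h.1 - b) + l * ‖h.2.1‖ ^ (1 + α) +
    M * (∑' i, γ i ^ (1 + α) - ∑ i ∈ Finset.range t, γ i ^ (1 + α)) + |h.2.2.2| + ‖h.2.2.1 + a‖ ^ 2

omit [InnerProductSpace ℝ E] [CompleteSpace E] in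
theorem momentumLyapunov_nonneg {f : E → ℝ} {b α l M : ℝ} {γ : ℕ → ℝ} (hb : ∀ x, b ≤ f x)
    (hl : 0 ≤ l) (hM : 0 ≤ M) (hγ : ∀ t, 0 ≤ γ t) (hs : Summable fun t => γ t ^ (1 + α))
    (a : E) (t : ℕ) (h : E × E × E × ℝ) : 0 ≤ momentumLyapunov f b α l M γ a t h := by
  have h1 := sub_nonneg.2 (hb h.1)
  have h2 := sub_nonneg.2 (hs.sum_le_tsum (Finset.range t)
    fun i _ => Real.rpow_nonneg (hγ i) (1 + α))
  unfold momentumLyapunov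
  positivity

/-- The term linear in the centred noise integrates to zero. Nonnegativity of `φ` passes to its
upper bound, whose lower integral is therefore its Bochner integral. -/
theorem lintegral_ofReal_le_of_affine_bound {Ω : Type*} [MeasurableSpace Ω] {μ : Measure Ω}
    [IsProbabilityMeasure μ] {φ : Ω → ℝ} {δ : Ω → E} {v : E} {c k s ψ : ℝ}
    (hφ0 : ∀ ω, 0 ≤ φ ω) (hφ : ∀ ω, φ ω ≤ c + inner ℝ v (δ ω) + k * ‖δ ω‖ ^ 2)
    (hδ : Integrable δ μ) (hδ0 : ∫ ω, δ ω ∂μ = 0) (hδ2 : Integrable (fun ω => ‖δ ω‖ ^ 2) μ)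
    (hs : ∫ ω, ‖δ ω‖ ^ 2 ∂μ ≤ s) (hk : 0 ≤ k) (hψ : c + k * s ≤ ψ) :
    ∫⁻ ω, ENNReal.ofReal (φ ω) ∂μ ≤ ENNReal.ofReal ψ := by
  have hi1 : Integrable (fun ω => inner ℝ v (δ ω)) μ := hδ.const_inner v
  have hi2 := hδ2.const_mul k
  have hi : Integrable (fun ω => c + inner ℝ v (δ ω) + k * ‖δ ω‖ ^ 2) μ :=
    ((integrable_const c).add hi1).add hi2
  have hint : ∫ ω, c + inner ℝ v (δ ω) + k * ‖δ ω‖ ^ 2 ∂μ = c + k * ∫ ω, ‖δ ω‖ ^ 2 ∂μ := by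
    have h1 : ∫ ω, c + inner ℝ v (δ ω) + k * ‖δ ω‖ ^ 2 ∂μ =
        ∫ ω, (c + inner ℝ v (δ ω)) ∂μ + ∫ ω, k * ‖δ ω‖ ^ 2 ∂μ :=
      integral_add ((integrable_const c).add hi1) hi2
    rw [h1, integral_add (integrable_const c) hi1, integral_const_mul, integral_inner hδ, hδ0]
    simp
  calc ∫⁻ ω, ENNReal.ofReal (φ ω) ∂μ
      ≤ ∫⁻ ω, ENNReal.ofReal (c + inner ℝ v (δ ω) + k * ‖δ ω‖ ^ 2) ∂μ :=
        lintegral_mono fun ω => ENNReal.ofReal_le_ofReal (hφ ω)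
    _ = ENNReal.ofReal (∫ ω, c + inner ℝ v (δ ω) + k * ‖δ ω‖ ^ 2 ∂μ) :=
        (ofReal_integral_eq_lintegral_ofReal hi
          (Eventually.of_forall fun ω => (hφ0 ω).trans (hφ ω))).symm
    _ ≤ ENNReal.ofReal ψ := by
        refine ENNReal.ofReal_le_ofReal ?_
        rw [hint]
        nlinarith [mul_le_mul_of_nonneg_left hs hk]

theorem tendsto_zero_of_summable_rpow {p : ℝ} (hp : 0 < p) {y : ℕ → ℝ} (hy : ∀ t, 0 ≤ y t)
    (hs : Summable fun t => y t ^ p) : Tendsto y atTop (𝓝 0) := by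
  have h := hs.tendsto_atTop_zero.rpow_const (p := 1 / p) (Or.inr (by positivity))
  rw [Real.zero_rpow (by positivity)] at h
  refine h.congr fun t => ?_
  rw [← Real.rpow_mul (hy t), mul_one_div_cancel hp.ne', Real.rpow_one]

/-- The Lyapunov function eventually does not increase in expectation. -/
theorem exists_momentumLyapunov_lintegral_le {Ω : Type*} [MeasurableSpace Ω] {μ : Measure Ω}
    [IsProbabilityMeasure μ] {f : E → ℝ} {g : E → S → E} {ξ : ℕ → Ω → S}
    (hf : Differentiable ℝ f) {b : ℝ} (hb : ∀ x, b ≤ f x) {A α : ℝ} (hA : 0 ≤ A) (hα0 : 0 < α)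
    (hα1 : α ≤ 1) (hH : ∀ x y, ‖gradient f x - gradient f y‖ ≤ A * ‖x - y‖ ^ α)
    {β : ℝ} (hβ0 : 0 ≤ β) (hβ1 : β < 1) (κ : ℝ)
    (hmean : ∀ t x, Integrable (fun ω => g x (ξ t ω)) μ ∧
      ∫ ω, g x (ξ t ω) ∂μ = gradient f x)
    {σ C : ℝ} (hvar : ∀ t x,
      Integrable (fun ω => ‖g x (ξ t ω) - gradient f x‖ ^ 2) μ ∧
      ∫ ω, ‖g x (ξ t ω) - gradient f x‖ ^ 2 ∂μ ≤ σ ^ 2 + C * ‖gradient f x‖ ^ 2)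
    {γ : ℕ → ℝ} (hγ0 : ∀ t, 0 ≤ γ t) (hγ2 : Summable fun t => γ t ^ (1 + α)) :
    ∃ l M : ℝ, ∃ T : ℕ, 0 ≤ l ∧ 0 ≤ M ∧ ∀ a t, T ≤ t → ∀ h,
      ∫⁻ ω, ENNReal.ofReal (momentumLyapunov f b α l M γ a (t + 1)
        (momentumStep f g β κ α γ t h (ξ t ω))) ∂μ ≤
      ENNReal.ofReal (momentumLyapunov f b α l M γ a t h) := by
  obtain ⟨l, K, hl, hK, hbound⟩ := exists_lyapunov_step_bound hf hA hα0 hα1 hH hβ0 hβ1 κ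
  set r := 1 / (1 - β) with hr
  set K' := K + r ^ 2 with hK'
  have hK'0 : 0 ≤ K' := by positivity
  -- The tail of `∑ γ ^ (1 + α)` drops by one term per step; with this weight it pays for the error
  -- independent of the gradient, including the variance floor `σ ^ 2`.
  set M := K + K' * σ ^ 2 with hM
  have hM0 : 0 ≤ M := by positivity
  have hγt : Tendsto γ atTop (𝓝 0) := tendsto_zero_of_summable_rpow (by positivity) hγ0 hγ2
  have hγα : Tendsto (fun t => γ t ^ α * (K + K' * C)) atTop (𝓝 0) := by
    have := (hγt.rpow_const (p := α) (Or.inr hα0.le)).mul_const (K + K' * C)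
    rwa [Real.zero_rpow hα0.ne', zero_mul] at this
  -- Past `T`, the gradient-dependent error costs at most `γ / 4 * ‖G‖ ^ 2`, half of the available
  -- decrease; the other half is recorded in `Q`.
  obtain ⟨T, hT⟩ := eventually_atTop.1 ((hγt.eventually (gt_mem_nhds one_pos)).and
    (hγα.eventually (gt_mem_nhds (show (0 : ℝ) < 1 / 4 by norm_num))))
  refine ⟨l, M, T, hl, hM0, fun a t ht h => ?_⟩
  obtain ⟨hγ1, hγ4⟩ := hT t ht
  have hγt0 := hγ0 t
  set G := gradient f (queryPoint β h) with hG
  have hγp : γ t ^ (1 + α) = γ t * γ t ^ α := by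
    rw [Real.rpow_add' hγt0 (by positivity), Real.rpow_one]
  have hγsq : γ t ^ 2 ≤ γ t ^ (1 + α) := by
    rw [← Real.rpow_two]
    exact Real.rpow_le_rpow_of_exponent_ge' hγt0 hγ1.le (by positivity) (by linarith)
  have hγp0 : 0 ≤ γ t ^ (1 + α) := Real.rpow_nonneg hγt0 _
  have hsmall : γ t ^ (1 + α) * (K + K' * C) ≤ γ t / 4 := by
    rw [hγp, mul_assoc]
    nlinarith
  obtain ⟨hm1, hm2⟩ := hmean t (queryPoint β h)
  obtain ⟨hv1, hv2⟩ := hvar t (queryPoint β h)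
  refine lintegral_ofReal_le_of_affine_bound (δ := fun ω => g (queryPoint β h) (ξ t ω) - G)
    -- The noise enters linearly twice: through the Taylor expansion at `z` and through the
    -- expansion of `‖N + a‖ ^ 2`.
    (v := -(γ t / (1 - β)) • (gradient f h.1 + (2 : ℝ) • (h.2.2.1 + a)))
    (c := f h.1 - b + (l * ‖h.2.1‖ ^ (1 + α) - ‖h.2.1‖ ^ (1 + α)) - γ t / 2 * ‖G‖ ^ 2
      + γ t ^ (1 + α) * (K * (1 + ‖G‖ ^ 2))
      + M * (∑' i, γ i ^ (1 + α) - ∑ i ∈ Finset.range (t + 1), γ i ^ (1 + α))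
      + (|h.2.2.2| + (γ t / 4 * ‖G‖ ^ 2 + ‖h.2.1‖ ^ (1 + α))) + ‖h.2.2.1 + a‖ ^ 2)
    (k := γ t ^ (1 + α) * K')
    (fun ω => momentumLyapunov_nonneg hb hl hM0 hγ0 hγ2 a _ _) (fun ω => ?_)
    (hm1.sub (integrable_const G)) ?_ hv1 hv2 (by positivity) ?_
  · set δ := g (queryPoint β h) (ξ t ω) - G with hδ
    have hgδ : g (queryPoint β h) (ξ t ω) = G + δ := by rw [hδ]; abel
    have h1 := hbound (γ t) h.1 h.2.1 δ G hγt0 hγ1.le hG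
    -- The absolute value keeps the Lyapunov function nonnegative at every state, even one with `Q <
    -- 0`; it costs nothing, since the increments of `Q` are nonnegative.
    have h2 : |h.2.2.2 + (γ t / 4 * ‖G‖ ^ 2 + ‖h.2.1‖ ^ (1 + α))| ≤
        |h.2.2.2| + (γ t / 4 * ‖G‖ ^ 2 + ‖h.2.1‖ ^ (1 + α)) := by
      refine (abs_add_le _ _).trans (le_of_eq ?_)
      rw [abs_of_nonneg (show 0 ≤ γ t / 4 * ‖G‖ ^ 2 + ‖h.2.1‖ ^ (1 + α) by positivity)]
    have h3 : ‖h.2.2.1 - (γ t / (1 - β)) • δ + a‖ ^ 2 ≤ ‖h.2.2.1 + a‖ ^ 2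
        - 2 * (γ t / (1 - β)) * inner ℝ (h.2.2.1 + a) δ + γ t ^ (1 + α) * (r ^ 2 * ‖δ‖ ^ 2) := by
      rw [show h.2.2.1 - (γ t / (1 - β)) • δ + a = h.2.2.1 + a - (γ t / (1 - β)) • δ by abel,
        norm_sub_sq_real, inner_smul_right, norm_smul, mul_pow, Real.norm_eq_abs, sq_abs]
      have h4 : (γ t / (1 - β)) ^ 2 * ‖δ‖ ^ 2 = γ t ^ 2 * (r ^ 2 * ‖δ‖ ^ 2) := by rw [hr]; ring
      have h5 : γ t ^ 2 * (r ^ 2 * ‖δ‖ ^ 2) ≤ γ t ^ (1 + α) * (r ^ 2 * ‖δ‖ ^ 2) := by gcongr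
      linarith
    rw [inner_add_left] at h3
    simp only [momentumLyapunov, momentumStep, ← hG, hgδ, add_sub_cancel_left, inner_smul_left,
      inner_add_left, hK', conj_trivial] at h3 ⊢
    linarith only [h1, h2, h3]
  · rw [integral_sub hm1 (integrable_const G), hm2]
    simp [hG]
  · have h1 := mul_le_mul_of_nonneg_right hsmall (sq_nonneg ‖G‖)
    simp only [momentumLyapunov]
    rw [Finset.sum_range_succ, hM]
    linarith only [h1]

/-- Pathwise conclusion: convergence of the Lyapunov functions for enough shifts `a` of the noise
forces convergence of the function values, of the gradients and of the increments. -/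
theorem tendsto_of_tendsto_momentumLyapunov {ι : Type*} [Fintype ι] (e : OrthonormalBasis ι ℝ E)
    {f : E → ℝ} {g : E → S → E} (hf : Differentiable ℝ f) {b : ℝ} (hb : ∀ x, b ≤ f x)
    {A α : ℝ} (hA : 0 < A) (hα0 : 0 < α)
    (hH : ∀ x y, ‖gradient f x - gradient f y‖ ≤ A * ‖x - y‖ ^ α)
    {β κ l M : ℝ} (hβ1 : β < 1) (hl : 0 ≤ l) (hM : 0 ≤ M)
    {γ : ℕ → ℝ} (hγ0 : ∀ t, 0 ≤ γ t)
    (hγ1 : Tendsto (fun n => ∑ t ∈ Finset.range n, γ t) atTop atTop)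
    (hγ2 : Summable fun t => γ t ^ (1 + α))
    {X : ℕ → E × E × E × ℝ} {u : ℕ → S} {x₀ : E} (hX0 : X 0 = (x₀, 0, 0, 0))
    (hX : ∀ t, X (t + 1) = momentumStep f g β κ α γ t (X t) (u t))
    (h0 : ∃ L, Tendsto (fun t => momentumLyapunov f b α l M γ 0 t (X t)) atTop (𝓝 L))
    (he : ∀ i, ∃ L, Tendsto (fun t => momentumLyapunov f b α l M γ (e i) t (X t)) atTop (𝓝 L)) :
    (∃ L, Tendsto (fun t => f (queryPoint β (X t))) atTop (𝓝 L)) ∧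
      Tendsto (fun t => gradient f (queryPoint β (X t))) atTop (𝓝 0) ∧
      Tendsto (fun t => dist (queryPoint β (X (t + 1))) (queryPoint β (X t))) atTop (𝓝 0) := by
  have hβ : 0 < 1 - β := by linarith
  have hp : 0 < 1 + α := by positivity
  set x : ℕ → E := fun t => queryPoint β (X t) with hx
  set c := β / (1 - β) with hc
  set r := 1 / (1 - β) with hr
  have hr0 : 0 ≤ r := by positivity
  let d : ℕ → ℝ := fun i => γ i / 4 * ‖gradient f (x i)‖ ^ 2 + ‖(X i).2.1‖ ^ (1 + α)
  have hd0 : ∀ i, 0 ≤ d i := fun i => by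
    have := hγ0 i
    positivity
  have hQ : ∀ t, (X t).2.2.2 = ∑ i ∈ Finset.range t, d i := by
    intro t
    induction t with
    | zero => simp [hX0]
    | succ t ih => rw [Finset.sum_range_succ, ← ih, hX]; rfl
  obtain ⟨L, hL⟩ := h0
  have hds : Summable d := by
    obtain ⟨B, hB⟩ := hL.bddAbove_range
    refine summable_of_sum_range_le (c := B) hd0 fun t => ?_
    have h1 : momentumLyapunov f b α l M γ 0 t (X t) ≤ B := hB (Set.mem_range_self t)
    refine le_trans ?_ h1
    have h2 := sub_nonneg.2 (hb (X t).1)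
    have h3 := sub_nonneg.2 (hγ2.sum_le_tsum (Finset.range t)
      fun i _ => Real.rpow_nonneg (hγ0 i) (1 + α))
    have h4 : 0 ≤ l * ‖(X t).2.1‖ ^ (1 + α) := by positivity
    have h5 := mul_nonneg hM h3
    have h6 := sq_nonneg ‖(X t).2.2.1 + 0‖
    unfold momentumLyapunov
    rw [hQ, abs_of_nonneg (Finset.sum_nonneg fun i _ => hd0 i)]
    linarith
  have hGs : Summable fun t => γ t * ‖gradient f (x t)‖ ^ 2 := by
    refine Summable.of_nonneg_of_le (fun t => mul_nonneg (hγ0 t) (sq_nonneg _)) (fun t => ?_)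
      (hds.mul_left 4)
    have : 0 ≤ ‖(X t).2.1‖ ^ (1 + α) := by positivity
    simp only [d]
    linarith
  have hmp : Summable fun t => ‖(X t).2.1‖ ^ (1 + α) := by
    refine Summable.of_nonneg_of_le (fun t => by positivity) (fun t => ?_) hds
    have := hγ0 t
    exact le_add_of_nonneg_left (by positivity)
  have hm : Tendsto (fun t => (X t).2.1) atTop (𝓝 0) :=
    tendsto_zero_iff_norm_tendsto_zero.2
      (tendsto_zero_of_summable_rpow hp (fun t => norm_nonneg _) hmp)
  obtain ⟨N', hN⟩ : ∃ N', Tendsto (fun t => (X t).2.2.1) atTop (𝓝 N') := by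
    -- Polarization: the Lyapunov functions for `e i` and `0` differ by `2 * inner ℝ (e i) N + ‖e i‖
    -- ^ 2`, so each coordinate of the noise converges.
    have hco : ∀ i, ∃ y, Tendsto (fun t => inner ℝ (e i) (X t).2.2.1) atTop (𝓝 y) := by
      intro i
      obtain ⟨Li, hLi⟩ := he i
      refine ⟨_, (((hLi.sub hL).sub_const (‖e i‖ ^ 2)).div_const 2).congr fun t => ?_⟩
      simp only [momentumLyapunov, add_zero]
      rw [norm_add_sq_real, real_inner_comm]
      ring
    choose y hy using hco
    refine ⟨∑ i, y i • e i, ?_⟩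
    refine (tendsto_finsetSum Finset.univ fun i _ => (hy i).smul_const (e i)).congr fun t => ?_
    exact e.sum_repr' _
  let w : ℕ → E := fun t => x₀ + (X t).2.2.1 - c • (X t).2.1
  have hw : Tendsto w atTop (𝓝 (x₀ + N' - c • (0 : E))) :=
    (hN.const_add x₀).sub (hm.const_smul c)
  have hxw : ∀ t, x t = w t - r • ∑ i ∈ Finset.range t, γ i • gradient f (x i) := by
    have hz : ∀ t, (X t).1 = x₀ + (X t).2.2.1 -
        r • ∑ i ∈ Finset.range t, γ i • gradient f (x i) := by
      intro t
      induction t with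
      | zero => simp [hX0]
      | succ t ih =>
        have h1 : (X (t + 1)).1 = (X t).1 - (γ t / (1 - β)) • g (x t) (u t) := by rw [hX]; rfl
        have h2 : (X (t + 1)).2.2.1 = (X t).2.2.1 -
            (γ t / (1 - β)) • (g (x t) (u t) - gradient f (x t)) := by rw [hX]; rfl
        rw [h1, h2, ih, Finset.sum_range_succ, smul_add, smul_smul,
          show r * γ t = γ t / (1 - β) by rw [hr]; ring, smul_sub]
        abel
    intro t
    change (X t).1 - c • (X t).2.1 = _
    rw [hz t]
    simp only [w]
    abel
  have hG : Tendsto (fun t => gradient f (x t)) atTop (𝓝 0) :=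
    tendsto_zero_of_recursion hA hα0 hr0 hH hγ0 hγ1 hxw hw hGs
  refine ⟨?_, hG, ?_⟩
  · have hfz : Tendsto (fun t => f (X t).1) atTop (𝓝 (L - l * 0 - M * (∑' i, γ i ^ (1 + α) -
        ∑' i, γ i ^ (1 + α)) - ∑' i, d i - ‖N'‖ ^ 2 + b)) := by
      refine (((((hL.sub (hmp.tendsto_atTop_zero.const_mul l)).sub
        ((hγ2.hasSum.tendsto_sum_nat.const_sub _).const_mul M)).sub
        hds.hasSum.tendsto_sum_nat).sub (hN.norm.pow 2)).add_const b).congr fun t => ?_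
      simp only [momentumLyapunov, add_zero]
      rw [hQ, abs_of_nonneg (Finset.sum_nonneg fun i _ => hd0 i)]
      ring
    have hcm : Tendsto (fun t => c • (X t).2.1) atTop (𝓝 0) := by simpa using hm.const_smul c
    have hrem : Tendsto (fun t => f (X t).1 - f (x t) -
        inner ℝ (gradient f (x t)) (c • (X t).2.1)) atTop (𝓝 0) := by
      refine squeeze_zero_norm (a := fun t => A * ‖c • (X t).2.1‖ ^ (1 + α)) (fun t => ?_) ?_
      · have := abs_sub_sub_inner_gradient_le hf hA.le hα0 hH (x t) (c • (X t).2.1)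
        rwa [show x t + c • (X t).2.1 = (X t).1 from sub_add_cancel _ _] at this
      · have := (hcm.norm.rpow_const (p := 1 + α) (Or.inr hp.le)).const_mul A
        rwa [norm_zero, Real.zero_rpow hp.ne', mul_zero] at this
    refine ⟨_, ((hfz.sub hrem).sub (hG.inner hcm)).congr fun t => ?_⟩
    ring
  · have hγt : Tendsto γ atTop (𝓝 0) := tendsto_zero_of_summable_rpow hp hγ0 hγ2
    have h1 : Tendsto (fun t => w (t + 1) - w t - r • γ t • gradient f (x t)) atTop (𝓝 0) := by
      have := ((hw.comp (tendsto_add_atTop_nat 1)).sub hw).sub ((hγt.smul hG).const_smul r)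
      simpa using this
    refine (tendsto_zero_iff_norm_tendsto_zero.1 h1).congr fun t => ?_
    rw [dist_eq_norm]
    congr 1
    change _ = x (t + 1) - x t
    rw [hxw (t + 1), Finset.sum_range_succ, smul_add]
    nth_rewrite 3 [hxw t]
    abel

end Recursion

/-! ### Identification with the algorithm, and measurability. -/

section Assembly

variable {E S : Type*} [NormedAddCommGroup E] [InnerProductSpace ℝ E]

/-- The induction must carry `m = x - y^s` along with the query point; substituting it in the update
gives the driving coefficient `1 - (1 - β) * s`. -/
theorem queryPoint_eq_iterate [CompleteSpace E] {f : E → ℝ} {g : E → S → E} {β s α : ℝ}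
    (hβ1 : β < 1) {γ : ℕ → ℝ} {x₀ : E} {u : ℕ → S} {X : ℕ → E × E × E × ℝ}
    (hX0 : X 0 = (x₀, 0, 0, 0))
    (hX : ∀ t, X (t + 1) = momentumStep f g β (1 - (1 - β) * s) α γ t (X t) (u t)) (t : ℕ) :
    queryPoint β (X t) = StochasticUnifiedMomentum.iterate g β s γ x₀ u t := by
  have hne : 1 - β ≠ 0 := by linarith
  have key : ∀ t, queryPoint β (X t) = (StochasticUnifiedMomentum.state g β s γ x₀ u t).1 ∧
      (X t).2.1 = (StochasticUnifiedMomentum.state g β s γ x₀ u t).1 -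
        (StochasticUnifiedMomentum.state g β s γ x₀ u t).2 := by
    intro t
    induction t with
    | zero => simp [hX0, queryPoint, StochasticUnifiedMomentum.state]
    | succ t ih =>
      obtain ⟨h1, h2⟩ := ih
      have h3 : (X t).1 = (StochasticUnifiedMomentum.state g β s γ x₀ u t).1 +
          (β / (1 - β)) • (X t).2.1 := by
        rw [← h1, queryPoint, sub_add_cancel]
      constructor
      · rw [queryPoint, hX]
        simp only [momentumStep, StochasticUnifiedMomentum.state]
        rw [h1, h3, h2]
        match_scalars <;> field_simp <;> ring
      · rw [hX]
        simp only [momentumStep, StochasticUnifiedMomentum.state]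
        rw [h1, h2]
        match_scalars <;> ring
  exact (key t).1

variable [MeasurableSpace E] [BorelSpace E] [SecondCountableTopology E] [MeasurableSpace S]

theorem measurable_momentumStep [CompleteSpace E] {f : E → ℝ} {g : E → S → E}
    (hG : Measurable (gradient f)) (hg : Measurable (Function.uncurry g)) (β κ α : ℝ) (γ : ℕ → ℝ)
    (t : ℕ) : Measurable (Function.uncurry (momentumStep f g β κ α γ t)) := by
  have hq : Measurable fun p : (E × E × E × ℝ) × S => queryPoint β p.1 := by
    unfold queryPoint
    fun_prop
  have hgq : Measurable fun p : (E × E × E × ℝ) × S => g (queryPoint β p.1) p.2 :=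
    hg.comp (hq.prodMk measurable_snd)
  have hGq : Measurable fun p : (E × E × E × ℝ) × S => gradient f (queryPoint β p.1) := hG.comp hq
  unfold momentumStep Function.uncurry
  fun_prop

omit [InnerProductSpace ℝ E] [SecondCountableTopology E] in
theorem measurable_momentumLyapunov {f : E → ℝ} (hf : Measurable f) (b α l M : ℝ) (γ : ℕ → ℝ)
    (a : E) (t : ℕ) : Measurable (momentumLyapunov f b α l M γ a t) := by
  unfold momentumLyapunov
  simp only [← Real.norm_eq_abs]
  fun_prop

theorem tendsto_nhds_unique_of_mapClusterPt {X Y : Type*} [TopologicalSpace Y] [T2Space Y]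
    {F : Filter X} {u : X → Y} {y z : Y} (h : Tendsto u F (𝓝 y)) (hz : MapClusterPt z F u) :
    z = y :=
  eq_of_nhds_neBot (hz.neBot.mono (inf_le_inf_left _ h))

end Assembly

/-! ### The convergence theorem. -/

theorem theorem2
    {d : ℕ} {Ω : Type*} [MeasurableSpace Ω] (μ : Measure Ω) [IsProbabilityMeasure μ]
    {S : Type*} [MeasurableSpace S]
    -- the cost function, the stochastic oracle and the samples
    (f : EuclideanSpace ℝ (Fin d) → ℝ)
    (g : EuclideanSpace ℝ (Fin d) → S → EuclideanSpace ℝ (Fin d))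
    (hg : Measurable (Function.uncurry g))
    (ξ : ℕ → Ω → S) (hξ : ∀ t, Measurable (ξ t))
    -- the parameters of the algorithm
    (β s : ℝ) (hβ0 : 0 ≤ β) (hβ1 : β < 1) (hs : 0 ≤ s)
    (γ : ℕ → ℝ) (x₀ : EuclideanSpace ℝ (Fin d))
    -- (A.1)
    (hf : ContDiff ℝ 1 f) (hfb : BddBelow (Set.range f))
    -- (A.2)
    (α : ℝ) (hα0 : 0 < α) (hα1 : α ≤ 1)
    (hHolder : ∃ A : ℝ, 0 < A ∧ ∀ x y, ‖gradient f x - gradient f y‖ ≤ A * ‖x - y‖ ^ α)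
    -- (A.3)
    (hmean : ∀ t x, Integrable (fun ω => g x (ξ t ω)) μ ∧
      ∫ ω, g x (ξ t ω) ∂μ = gradient f x)
    -- (A.4)
    (hvar : ∃ σ C : ℝ, 0 < σ ∧ 0 < C ∧ ∀ t x,
      Integrable (fun ω => ‖g x (ξ t ω) - gradient f x‖ ^ 2) μ ∧
      ∫ ω, ‖g x (ξ t ω) - gradient f x‖ ^ 2 ∂μ ≤ σ ^ 2 + C * ‖gradient f x‖ ^ 2)
    -- (A.5)
    (hindep : iIndepFun ξ μ)
    -- (A.6)
    (hγ0 : ∀ t, 0 ≤ γ t)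
    (hγ1 : Tendsto (fun n => ∑ t ∈ Finset.range n, γ t) atTop atTop)
    (hγ2 : Summable (fun t => γ t ^ (1 + α)))
    -- the iterates
    (x : ℕ → Ω → EuclideanSpace ℝ (Fin d))
    (hx : ∀ t ω, x t ω =
      StochasticUnifiedMomentum.iterate g β s γ x₀ (fun i => ξ i ω) t) :
    (∀ᵐ ω ∂μ, ∃ l : ℝ, Tendsto (fun t => f (x t ω)) atTop (𝓝 l)) ∧
    (∀ᵐ ω ∂μ, Tendsto (fun t => gradient f (x t ω)) atTop (𝓝 0)) ∧
    ((∀ a b : ℝ, a < b → {z | a ≤ f z ∧ f z ≤ b ∧ gradient f z = 0}.Finite) →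
      Tendsto f (Bornology.cobounded (EuclideanSpace ℝ (Fin d))) atTop →
      ∀ᵐ ω ∂μ, ∃ z, Tendsto (fun t => x t ω) atTop (𝓝 z)) := by
  classical
  obtain ⟨A, hA, hH⟩ := hHolder
  obtain ⟨σ, C, -, -, hvar⟩ := hvar
  obtain ⟨b, hb⟩ := hfb
  replace hb : ∀ z, b ≤ f z := fun z => hb (Set.mem_range_self z)
  have hfd : Differentiable ℝ f := hf.differentiable one_ne_zero
  have hgc : Continuous (gradient f) :=
    (InnerProductSpace.toDual ℝ _).symm.continuous.comp (hf.continuous_fderiv one_ne_zero)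
  set κ := 1 - (1 - β) * s with hκ
  obtain ⟨l, M, T, hl, hM, hstep⟩ := exists_momentumLyapunov_lintegral_le hfd hb hA.le hα0 hα1 hH
    hβ0 hβ1 κ hmean hvar hγ0 hγ2
  let X : ℕ → Ω → EuclideanSpace ℝ (Fin d) × EuclideanSpace ℝ (Fin d) ×
      EuclideanSpace ℝ (Fin d) × ℝ := fun t ω =>
    Nat.rec (x₀, 0, 0, 0) (fun t h => momentumStep f g β κ α γ t h (ξ t ω)) t
  have hX0 : ∀ ω, X 0 ω = (x₀, 0, 0, 0) := fun _ => rfl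
  have hX : ∀ t ω, X (t + 1) ω = momentumStep f g β κ α γ t (X t ω) (ξ t ω) := fun _ _ => rfl
  have hxX : ∀ t ω, x t ω = queryPoint β (X t ω) := fun t ω => by
    rw [hx, queryPoint_eq_iterate hβ1 (hX0 ω) (fun t => hX t ω)]
  have hlim : ∀ a, ∀ᵐ ω ∂μ, ∃ L,
      Tendsto (fun t => momentumLyapunov f b α l M γ a t (X t ω)) atTop (𝓝 L) := fun a =>
    ae_tendsto_lyapunov_of_iIndepFun hξ hindep
      (fun t => measurable_momentumStep hgc.measurable hg β κ α γ t) hX0 hX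
      (fun t => measurable_momentumLyapunov hf.continuous.measurable b α l M γ a t) T
      (fun t ω => momentumLyapunov_nonneg hb hl hM hγ0 hγ2 a t _) (hstep a)
  let e := EuclideanSpace.basisFun (Fin d) ℝ
  have hmain : ∀ᵐ ω ∂μ, (∃ L, Tendsto (fun t => f (x t ω)) atTop (𝓝 L)) ∧
      Tendsto (fun t => gradient f (x t ω)) atTop (𝓝 0) ∧
      Tendsto (fun t => dist (x (t + 1) ω) (x t ω)) atTop (𝓝 0) := by
    -- Finitely many shifts suffice, so the exceptional null sets can be united.
    filter_upwards [hlim 0, ae_all_iff.2 fun i => hlim (e i)] with ω h0 he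
    simp only [hxX]
    exact tendsto_of_tendsto_momentumLyapunov e hfd hb hA hα0 hH hβ1 hl hM hγ0 hγ1 hγ2
      (hX0 ω) (fun t => hX t ω) h0 he
  refine ⟨hmain.mono fun ω h => h.1, hmain.mono fun ω h => h.2.1, fun hfin hcoer =>
    hmain.mono fun ω ⟨⟨L, hL⟩, hG, hd⟩ => ?_⟩
  -- By continuity every cluster point is critical with value exactly `L`; the window around `L`
  -- only serves to meet the strict inequality in the finiteness hypothesis.
  refine exists_tendsto_of_finite_mapClusterPt ?_ hd (hfin (L - 1) (L + 1) (by linarith))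
    fun z hz => ?_
  · obtain ⟨B, hB⟩ := hL.bddAbove_range
    have hev := hcoer.eventually (eventually_gt_atTop B)
    refine (Bornology.isBounded_compl_iff.2
      (show Bornology.IsCobounded {z | B < f z} from hev)).subset ?_
    rintro _ ⟨t, rfl⟩
    have h1 : f (x t ω) ≤ B := hB (Set.mem_range_self t)
    simpa using h1
  · have h1 : f z = L := tendsto_nhds_unique_of_mapClusterPt hL
      (hz.continuousAt_comp hf.continuous.continuousAt)
    have h2 : gradient f z = 0 := tendsto_nhds_unique_of_mapClusterPt hG
      (hz.continuousAt_comp hgc.continuousAt)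
    exact ⟨by linarith, by linarith, h2⟩
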